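/- Let $(Q_n)_{n\ge 0}$ be the Yablonskii--Vorob'ev polynomials, defined by $Q_0=1$, $Q_1=z$ and $$Q_{n+1}Q_{n-1}=zQ_n^2-4\bigl(Q_nQ_n''-(Q_n')^2\bigr)\qquad(n\ge 1).$$ These equations do define a sequence of polynomials; $Q_n$ has $\tfrac12 n(n+1)$ complex roots $z_{n,k}$, $1\le k\le \tfrac12 n(n+1)$ (listed with multiplicity), and for $n\ge1$ the polynomials $Q_{n-1}$ and $Q_n$ have no common root. Moreover, for every $n\ge 1$: For $1\le j\le \tfrac12 n(n-1)$, $$\sum_{k=1}^{\frac12 n(n+1)}\frac{1}{(z_{n-1,j}-z_{n,k})^2}=-\frac{z_{n-1,j}}{4},\qquad \sum_{k=1}^{\frac12 n(n+1)}\frac{1}{(z_{n-1,j}-z_{n,k})^3}=\frac{n+1}{4},$$ $$\sum_{k=1}^{\frac12 n(n+1)}\frac{1}{(z_{n-1,j}-z_{n,k})^5}=-z_{n-1,j}\left(\frac{n+1}{24}-\frac1{48}\right).$$ For $1\le j\le \tfrac12 n(n+1)$, $$\sum_{k=1}^{\frac12 n(n-1)}\frac{1}{(z_{n,j}-z_{n-1,k})^2}=-\frac{z_{n,j}}{4},\qquad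 \sum_{k=1}^{\frac12 n(n-1)}\frac{1}{(z_{n,j}-z_{n-1,k})^3}=-\frac{n-1}{4},$$ $$\sum_{k=1}^{\frac12 n(n-1)}\frac{1}{(z_{n,j}-z_{n-1,k})^5}=z_{n,j}\left(\frac{n-1}{24}+\frac1{48}\right).$$ -/

import Mathlib

open Polynomial

/-- The Yablonskii--Vorob'ev polynomials `Q_n`, with `Q_0 = 1`, `Q_1 = z` and
`Q_{n+1} = (z Q_n^2 - 4 (Q_n Q_n'' - (Q_n')^2)) / Q_{n-1}`.
Here `/` is Euclidean division of polynomials. That the division is exact, so that the defining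
equation `Q_{n+1} Q_{n-1} = z Q_n^2 - 4 (Q_n Q_n'' - (Q_n')^2)` really holds,
is asserted as part of the theorem. -/
noncomputable def yablonskiiVorobev : ℕ → ℂ[X]
  | 0 => 1
  | 1 => X
  | n + 2 =>
      (X * yablonskiiVorobev (n + 1) ^ 2
        - 4 * (yablonskiiVorobev (n + 1) * derivative (derivative (yablonskiiVorobev (n + 1)))
          - derivative (yablonskiiVorobev (n + 1)) ^ 2))
      / yablonskiiVorobev n

/-- `rootSum n s z` is the sum of `1 / (z - w) ^ s` over all roots `w` of `Q_n`,
counted with multiplicity. -/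
noncomputable def rootSum (n s : ℕ) (z : ℂ) : ℂ :=
  ((yablonskiiVorobev n).roots.map fun w => 1 / (z - w) ^ s).sum

/-!
Consecutive polynomials `f = Q_n` and `g = Q_{n+1}` satisfy Hirota's bilinear equations
`D² f·g = 0` and `D³ f·g = z D f·g + ν f g` with `ν = n + 1`. Let `N` be the right-hand side of the
recurrence for `g`. Given the first equation, the second one says
`f' N = f (z g g' - 2 (g g'' - g'²)' - ν g²)`. As `f` and `g` are coprime, `D² f·g = 0` makes `f`
squarefree, so `f` divides `N`, and the quotient `h` satisfies `f h' - f' h = (2ν + 1) g²`. Hence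
`(g, h)` again solves the bilinear equations, with parameter `ν + 1`.

At a root of `f`, put `φ = f / g`, `ψ = h / g` and `G = g' / g`, whose Taylor coefficients there are
up to sign the sums over the roots of `g`. Both `φ` and `ψ` solve `y'' = -2 G' y`, with constant
Wronskian `2ν + 1`, and `v = φ ψ = z - 4 G'`. Comparing Taylor coefficients in `v`, `v'` and
`v''' = -4 G'' v - 8 G' v'` at the root, where `φ` vanishes, gives the sums of powers 2, 3 and 5.
The pair `(g, f)` is treated in the same way, with `-ν` in place of `ν`.
-/

section Hirota

variable {R A : Type*} [CommRing R] [CommRing A] [Algebra R A] (δ : Derivation R A A)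

/-- Hirota's bilinear operator `D²`, applied to `f · g`. -/
def hirotaD2 (f g : A) : A :=
  δ (δ f) * g - 2 * (δ f * δ g) + f * δ (δ g)

/-- Hirota's bilinear operator `D³`, applied to `f · g`. -/
def hirotaD3 (f g : A) : A :=
  δ (δ (δ f)) * g - 3 * (δ (δ f) * δ g) + 3 * (δ f * δ (δ g)) - f * δ (δ (δ g))

/-- The right-hand side `x g² - 4 (g g'' - g'²)` of the Yablonskii–Vorob'ev recurrence, in which
`g g'' - g'²` is `g² (log g)''`. -/
def todaPolynomial (x g : A) : A :=
  x * g ^ 2 - 4 * (g * δ (δ g) - δ g ^ 2)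

/-- The bilinear form `D² f·g = 0`, `D³ f·g = x D f·g + ν f g` of the second Painlevé equation:
`f` and `g` are the tau functions of the solution `(log (f / g))'`, with parameter `ν`. -/
structure IsHirotaPair (x ν f g : A) : Prop where
  hirotaD2_eq_zero : hirotaD2 δ f g = 0
  hirotaD3_eq : hirotaD3 δ f g = x * (δ f * g - f * δ g) + ν * (f * g)

variable {δ} {x ν f g h : A}

theorem hirotaD2_comm : hirotaD2 δ f g = hirotaD2 δ g f := by
  unfold hirotaD2; ring

theorem IsHirotaPair.symm (H : IsHirotaPair δ x ν f g) : IsHirotaPair δ x (-ν) g f where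
  hirotaD2_eq_zero := hirotaD2_comm.trans H.hirotaD2_eq_zero
  hirotaD3_eq := by
    have h3 := H.hirotaD3_eq
    unfold hirotaD3 at h3 ⊢
    linear_combination -h3

theorem mul_hirotaD3_of_hirotaD2_eq_zero (h2 : hirotaD2 δ f g = 0) :
    g * hirotaD3 δ f g =
      4 * δ f * (g * δ (δ g) - δ g ^ 2) - 2 * f * δ (g * δ (δ g) - δ g ^ 2) := by
  have dh2 := congrArg δ h2
  unfold hirotaD2 at h2 dh2
  have two : δ 2 = 0 := by exact_mod_cast δ.map_natCast 2
  simp only [map_add, map_sub, map_zero, Derivation.leibniz, Derivation.leibniz_pow, smul_eq_mul,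
    nsmul_eq_mul, two] at dh2 ⊢
  unfold hirotaD3
  push_cast
  linear_combination g * dh2 - 2 * δ g * h2

theorem derivation_todaPolynomial (hx : δ x = 1) :
    δ (todaPolynomial δ x g) =
      g ^ 2 + 2 * (x * g * δ g) - 4 * δ (g * δ (δ g) - δ g ^ 2) := by
  have four : δ 4 = 0 := by exact_mod_cast δ.map_natCast 4
  simp only [todaPolynomial, map_sub, Derivation.leibniz, Derivation.leibniz_pow, smul_eq_mul,
    nsmul_eq_mul, four, hx]
  push_cast
  ring

theorem IsHirotaPair.derivation_mul_todaPolynomial (H : IsHirotaPair δ x ν f g) :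
    δ f * todaPolynomial δ x g =
      f * (x * g * δ g - 2 * δ (g * δ (δ g) - δ g ^ 2) - ν * g ^ 2) := by
  unfold todaPolynomial
  linear_combination
    mul_hirotaD3_of_hirotaD2_eq_zero H.hirotaD2_eq_zero - g * H.hirotaD3_eq

theorem IsHirotaPair.of_derivation_mul_todaPolynomial [IsDomain A] (hg : g ≠ 0)
    (h2 : hirotaD2 δ f g = 0)
    (h3 : δ f * todaPolynomial δ x g =
      f * (x * g * δ g - 2 * δ (g * δ (δ g) - δ g ^ 2) - ν * g ^ 2)) :
    IsHirotaPair δ x ν f g where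
  hirotaD2_eq_zero := h2
  hirotaD3_eq := by
    refine mul_left_cancel₀ hg ?_
    unfold todaPolynomial at h3
    linear_combination mul_hirotaD3_of_hirotaD2_eq_zero h2 - h3

theorem hirotaD2_eq_zero_of_wronskian [IsDomain A] {c : A} (hf : f ≠ 0) (hc : δ c = 0)
    (h2 : hirotaD2 δ f g = 0) (hw : f * δ h - h * δ f = c * g ^ 2) : hirotaD2 δ g h = 0 := by
  have dhw := congrArg δ hw
  simp only [map_sub, Derivation.leibniz, Derivation.leibniz_pow, smul_eq_mul, nsmul_eq_mul,
    hc] at dhw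
  push_cast at dhw
  refine (mul_eq_zero.mp ?_).resolve_left hf
  unfold hirotaD2 at h2 ⊢
  linear_combination g * dhw + h * h2 - 2 * δ g * hw

section Backlund

variable [IsDomain A]

theorem IsHirotaPair.derivation_left_mul (H : IsHirotaPair δ x ν f g) (hf : f ≠ 0)
    (hN : h * f = todaPolynomial δ x g) :
    δ f * h = x * g * δ g - 2 * δ (g * δ (δ g) - δ g ^ 2) - ν * g ^ 2 := by
  refine mul_left_cancel₀ hf ?_
  linear_combination H.derivation_mul_todaPolynomial + δ f * hN

theorem IsHirotaPair.mul_derivation_right (H : IsHirotaPair δ x ν f g) (hf : f ≠ 0)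
    (hx : δ x = 1) (hN : h * f = todaPolynomial δ x g) :
    f * δ h = x * g * δ g - 2 * δ (g * δ (δ g) - δ g ^ 2) + (ν + 1) * g ^ 2 := by
  have dN := (congrArg δ hN).trans (derivation_todaPolynomial hx)
  simp only [Derivation.leibniz, smul_eq_mul] at dN
  linear_combination dN - H.derivation_left_mul hf hN

theorem IsHirotaPair.wronskian_eq (H : IsHirotaPair δ x ν f g) (hf : f ≠ 0) (hx : δ x = 1)
    (hN : h * f = todaPolynomial δ x g) : f * δ h - h * δ f = (2 * ν + 1) * g ^ 2 := by
  linear_combination H.mul_derivation_right hf hx hN - H.derivation_left_mul hf hN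

theorem IsHirotaPair.hirotaD2_right_eq_zero (H : IsHirotaPair δ x ν f g) (hf : f ≠ 0)
    (hx : δ x = 1) (hν : δ ν = 0) (hN : h * f = todaPolynomial δ x g) : hirotaD2 δ g h = 0 := by
  have two : δ 2 = 0 := by exact_mod_cast δ.map_natCast 2
  refine hirotaD2_eq_zero_of_wronskian hf ?_ H.hirotaD2_eq_zero (H.wronskian_eq hf hx hN)
  simp only [map_add, Derivation.leibniz, Derivation.map_one_eq_zero, smul_eq_mul, hν, two,
    mul_zero, add_zero]

/-- The Bäcklund transformation `ν ↦ ν + 1`. -/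
theorem IsHirotaPair.backlund (H : IsHirotaPair δ x ν f g) (hf : f ≠ 0) (hg : g ≠ 0)
    (hx : δ x = 1) (hν : δ ν = 0) (hN : h * f = todaPolynomial δ x g) :
    IsHirotaPair δ x (ν + 1) g h := by
  suffices H' : IsHirotaPair δ x (-(ν + 1)) h g by simpa only [neg_neg] using H'.symm
  refine .of_derivation_mul_todaPolynomial hg
    (hirotaD2_comm.trans (H.hirotaD2_right_eq_zero hf hx hν hN)) ?_
  linear_combination h * H.mul_derivation_right hf hx hN - δ h * hN

end Backlund

section Map

variable {R' B : Type*} [CommRing R'] [CommRing B] [Algebra R' B] {δ' : Derivation R' B B}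
  {σ : A →+* B}

theorem map_hirotaD2 (hσ : ∀ a, σ (δ a) = δ' (σ a)) :
    σ (hirotaD2 δ f g) = hirotaD2 δ' (σ f) (σ g) := by
  simp only [hirotaD2, map_add, map_sub, map_mul, map_ofNat, hσ]

theorem map_todaPolynomial (hσ : ∀ a, σ (δ a) = δ' (σ a)) :
    σ (todaPolynomial δ x g) = todaPolynomial δ' (σ x) (σ g) := by
  simp only [todaPolynomial, map_sub, map_mul, map_pow, map_ofNat, hσ]

end Map

section Schrodinger

variable {φ ψ G u : A}

theorem schrodinger_of_hirotaD2_eq_zero [IsDomain A] (hg : g ≠ 0) (hG : δ g = g * G)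
    (h2 : hirotaD2 δ (g * φ) g = 0) : δ (δ φ) = -(2 * δ G * φ) := by
  refine mul_left_cancel₀ (pow_ne_zero 2 hg) ?_
  simp only [hirotaD2, Derivation.leibniz, map_add, smul_eq_mul, hG] at h2
  linear_combination h2

theorem todaPolynomial_of_logDeriv (hG : δ g = g * G) :
    todaPolynomial δ x g = g ^ 2 * (x - 4 * δ G) := by
  simp only [todaPolynomial, Derivation.leibniz, smul_eq_mul, hG]
  ring

theorem wronskian_mul_left :
    g * φ * δ (g * ψ) - g * ψ * δ (g * φ) = g ^ 2 * (φ * δ ψ - ψ * δ φ) := by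
  simp only [Derivation.leibniz, smul_eq_mul]
  ring

theorem derivation_iterate_three_mul_of_schrodinger (hφ : δ (δ φ) = -(u * φ))
    (hψ : δ (δ ψ) = -(u * ψ)) :
    δ (δ (δ (φ * ψ))) = -(2 * δ u * (φ * ψ)) - 4 * u * δ (φ * ψ) := by
  simp only [Derivation.leibniz, map_add, map_neg, smul_eq_mul, hφ, hψ]
  ring

end Schrodinger

theorem derivation_multiset_prod_map {ι : Type*} {a b : ι → A} {s : Multiset ι}
    (hab : ∀ i ∈ s, δ (a i) = a i * b i) :
    δ (s.map a).prod = (s.map a).prod * (s.map b).sum := by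
  induction s using Multiset.induction_on with
  | empty => simp
  | cons i s ih =>
    simp only [Multiset.map_cons, Multiset.prod_cons, Multiset.sum_cons, Derivation.leibniz,
      smul_eq_mul, ih fun j hj => hab j (Multiset.mem_cons_of_mem hj),
      hab i (Multiset.mem_cons_self i s)]
    ring

end Hirota

section TaylorSeries

variable {S : Type*} [CommSemiring S] {z : S} {g : S[X]}

/-- The Taylor expansion of a polynomial at `z`, as a power series. -/
noncomputable def taylorSeries (z : S) : S[X] →+* PowerSeries S :=
  coeToPowerSeries.ringHom.comp (taylorAlgHom z : S[X] →+* S[X])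

theorem taylorSeries_apply (z : S) (g : S[X]) : taylorSeries z g = (taylor z g : PowerSeries S) :=
  rfl

theorem taylorSeries_X (z : S) : taylorSeries z X = PowerSeries.X + PowerSeries.C z := by
  rw [taylorSeries_apply, taylor_X, coe_add, coe_X, coe_C]

theorem taylorSeries_C (z a : S) : taylorSeries z (C a) = PowerSeries.C a := by
  rw [taylorSeries_apply, taylor_C, coe_C]

theorem constantCoeff_taylorSeries (z : S) (g : S[X]) :
    PowerSeries.constantCoeff (taylorSeries z g) = g.eval z := by
  rw [taylorSeries_apply, ← PowerSeries.coeff_zero_eq_constantCoeff_apply, coeff_coe,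
    taylor_coeff_zero]

theorem taylorSeries_derivative (z : S) (g : S[X]) :
    taylorSeries z (derivative g) = PowerSeries.derivative S (taylorSeries z g) := by
  rw [taylorSeries_apply, taylorSeries_apply, PowerSeries.derivative_coe, taylor_apply,
    taylor_apply, derivative_comp]
  simp

end TaylorSeries

section LogDerivSeries

variable {K : Type*} [Field K] {z : K} {g : K[X]}

theorem isUnit_taylorSeries (hg : g.eval z ≠ 0) : IsUnit (taylorSeries z g) := by
  rw [PowerSeries.isUnit_iff_constantCoeff, constantCoeff_taylorSeries]
  exact hg.isUnit

theorem coeff_inv_X_add_C {a : K} (ha : a ≠ 0) (k : ℕ) :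
    PowerSeries.coeff k (PowerSeries.X + PowerSeries.C a)⁻¹ = (-1) ^ k * (1 / a ^ (k + 1)) := by
  suffices h : (PowerSeries.X + PowerSeries.C a)⁻¹ =
      PowerSeries.mk fun k => (-1) ^ k * (1 / a ^ (k + 1)) by rw [h, PowerSeries.coeff_mk]
  rw [PowerSeries.inv_eq_iff_mul_eq_one (by simpa using ha)]
  ext (_ | k)
  · simp [ha]
  · simp only [mul_add, map_add, PowerSeries.coeff_succ_mul_X, PowerSeries.coeff_mul_C,
      PowerSeries.coeff_mk, PowerSeries.coeff_one, Nat.succ_ne_zero, if_false]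
    field_simp
    ring

/-- The Taylor expansion at `z` of `∑ 1 / (X - w)`, the logarithmic derivative of the monic
polynomial with roots `s`; its coefficients give the sums of `1 / (z - w) ^ k` over `s`. An entry
`w = z` of `s` contributes the junk value `X⁻¹ = 0`. -/
noncomputable def logDerivSeries (s : Multiset K) (z : K) : PowerSeries K :=
  (s.map fun w => (PowerSeries.X + PowerSeries.C (z - w))⁻¹).sum

theorem coeff_logDerivSeries {s : Multiset K} (hs : z ∉ s) (k : ℕ) :
    PowerSeries.coeff k (logDerivSeries s z) =
      (-1) ^ k * (s.map fun w => 1 / (z - w) ^ (k + 1)).sum := by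
  rw [logDerivSeries, map_multiset_sum, Multiset.map_map, ← Multiset.sum_map_mul_left]
  refine congrArg Multiset.sum (Multiset.map_congr rfl fun w hw => ?_)
  exact coeff_inv_X_add_C (sub_ne_zero.mpr (ne_of_mem_of_not_mem hw hs).symm) k

theorem derivative_taylorSeries_of_splits (hs : g.Splits) (hg : g.eval z ≠ 0) :
    PowerSeries.derivative K (taylorSeries z g) =
      taylorSeries z g * logDerivSeries g.roots z := by
  have hlin (w : K) (hw : w ∈ g.roots) :
      PowerSeries.derivative K (taylorSeries z (X - C w)) =
        taylorSeries z (X - C w) * (PowerSeries.X + PowerSeries.C (z - w))⁻¹ := by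
    have hzw : z - w ≠ 0 := sub_ne_zero.mpr fun h => hg (h ▸ isRoot_of_mem_roots hw)
    have hexp : taylorSeries z (X - C w) = PowerSeries.X + PowerSeries.C (z - w) := by
      rw [map_sub, taylorSeries_X, taylorSeries_C, map_sub, add_sub_assoc]
    rw [hexp, PowerSeries.mul_inv_cancel _ (by simpa using hzw), map_add,
      PowerSeries.derivative_X, PowerSeries.derivative_C, add_zero]
  have hprod : taylorSeries z g = PowerSeries.C g.leadingCoeff *
      (g.roots.map fun w => taylorSeries z (X - C w)).prod := by
    conv_lhs => rw [hs.eq_prod_roots]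
    rw [map_mul, taylorSeries_C, map_multiset_prod, Multiset.map_map, Function.comp_def]
  rw [hprod, Derivation.leibniz, PowerSeries.derivative_C, derivation_multiset_prod_map hlin,
    logDerivSeries, smul_zero, add_zero, smul_eq_mul, mul_assoc]

theorem coeff_of_schrodinger_pair [CharZero K] {φ ψ G : PowerSeries K} {z c : K}
    (hφ : PowerSeries.derivative K (PowerSeries.derivative K φ) =
      -(2 * PowerSeries.derivative K G * φ))
    (hψ : PowerSeries.derivative K (PowerSeries.derivative K ψ) =
      -(2 * PowerSeries.derivative K G * ψ))
    (hw : φ * PowerSeries.derivative K ψ - ψ * PowerSeries.derivative K φ = PowerSeries.C c)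
    (hv : φ * ψ = PowerSeries.X + PowerSeries.C z - 4 * PowerSeries.derivative K G)
    (h0 : PowerSeries.constantCoeff φ = 0) :
    PowerSeries.coeff 1 G = z / 4 ∧ PowerSeries.coeff 2 G = (c + 1) / 8 ∧
      PowerSeries.coeff 4 G = -(c * z / 48) := by
  have two : (2 : PowerSeries K) = PowerSeries.C 2 := (map_ofNat PowerSeries.C 2).symm
  have four : (4 : PowerSeries K) = PowerSeries.C 4 := (map_ofNat PowerSeries.C 4).symm
  have hdv : PowerSeries.derivative K (φ * ψ) =
      2 * φ * PowerSeries.derivative K ψ - PowerSeries.C c := by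
    rw [Derivation.leibniz, smul_eq_mul, smul_eq_mul]
    linear_combination -hw
  have hd3v := derivation_iterate_three_mul_of_schrodinger hφ hψ
  rw [hv] at hdv hd3v
  have v₀ := congrArg PowerSeries.constantCoeff hv
  have v₁ := congrArg PowerSeries.constantCoeff hdv
  have v₃ := congrArg PowerSeries.constantCoeff hd3v
  simp only [two, four, map_add, map_sub, map_mul, map_neg, h0, Derivation.leibniz, smul_eq_mul,
    PowerSeries.derivative_X, PowerSeries.derivative_C, Derivation.map_one_eq_zero,
    PowerSeries.constantCoeff_X, PowerSeries.constantCoeff_C, map_one, map_zero] at v₀ v₁ v₃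
  simp only [← PowerSeries.coeff_zero_eq_constantCoeff_apply,
    PowerSeries.coeff_derivative, Nat.reduceAdd, Nat.cast_zero, Nat.cast_one, Nat.cast_ofNat,
    zero_mul] at v₀ v₁ v₃
  have G₁ : PowerSeries.coeff 1 G = z / 4 := by linear_combination v₀ / 4
  have G₂ : PowerSeries.coeff 2 G = (c + 1) / 8 := by linear_combination -v₁ / 8
  refine ⟨G₁, G₂, ?_⟩
  rw [G₁, G₂] at v₃
  linear_combination -v₃ / 96

end LogDerivSeries

section Degree

variable {S : Type*} [CommRing S] [IsDomain S] {f g h : S[X]}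

theorem natDegree_todaPolynomial (hg : g ≠ 0) :
    (todaPolynomial derivative' X g).natDegree = 2 * g.natDegree + 1 := by
  have hlead : (X * g ^ 2).natDegree = 2 * g.natDegree + 1 := by
    rw [natDegree_X_mul (pow_ne_zero 2 hg), natDegree_pow]
  have hd : (derivative g).natDegree ≤ g.natDegree :=
    (natDegree_derivative_le g).trans (Nat.sub_le _ _)
  have hdd : (derivative (derivative g)).natDegree ≤ g.natDegree :=
    (natDegree_derivative_le _).trans ((Nat.sub_le _ _).trans hd)
  have hgdd : (g * derivative (derivative g)).natDegree ≤ 2 * g.natDegree :=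
    two_mul g.natDegree ▸ natDegree_mul_le_of_le le_rfl hdd
  have hlow : (4 * (g * derivative (derivative g) - derivative g ^ 2)).natDegree <
      (X * g ^ 2).natDegree := by
    rw [hlead, Nat.lt_succ_iff, ← zero_add (2 * g.natDegree)]
    exact natDegree_mul_le_of_le (natDegree_ofNat 4).le
      ((natDegree_sub_le _ _).trans (max_le hgdd (natDegree_pow_le_of_le 2 hd)))
  exact (natDegree_sub_eq_left_of_natDegree_lt hlow).trans hlead

theorem todaPolynomial_ne_zero (hg : g ≠ 0) : todaPolynomial derivative' X g ≠ 0 :=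
  ne_zero_of_natDegree_gt (n := 2 * g.natDegree) (by rw [natDegree_todaPolynomial hg]; omega)

theorem natDegree_add_of_mul_eq_todaPolynomial (hg : g ≠ 0)
    (hN : h * f = todaPolynomial derivative' X g) :
    h.natDegree + f.natDegree = 2 * g.natDegree + 1 := by
  obtain ⟨hh, hf⟩ := mul_ne_zero_iff.mp (hN ▸ todaPolynomial_ne_zero hg)
  rw [← natDegree_mul hh hf, hN, natDegree_todaPolynomial hg]

end Degree

section TauPair

variable {K : Type*} [Field K]

/-- Coprime nonzero polynomials forming a Hirota pair with respect to `d/dX`: the tau functions of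
a rational solution of the second Painlevé equation. -/
structure IsTauPair (ν : K) (f g : K[X]) : Prop
    extends IsHirotaPair derivative' X (C ν) f g where
  left_ne_zero : f ≠ 0
  right_ne_zero : g ≠ 0
  isCoprime : IsCoprime f g

variable {ν : K} {f g h : K[X]}

theorem IsTauPair.eval_right_ne_zero (H : IsTauPair ν f g) {z : K}
    (hz : f.IsRoot z) : g.eval z ≠ 0 := fun hz' =>
  not_isUnit_X_sub_C z (H.isCoprime.isUnit_of_dvd' (dvd_iff_isRoot.mpr hz) (dvd_iff_isRoot.mpr hz'))

theorem IsTauPair.symm (H : IsTauPair ν f g) : IsTauPair (-ν) g f where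
  toIsHirotaPair := by simpa only [C_neg] using H.toIsHirotaPair.symm
  left_ne_zero := H.right_ne_zero
  right_ne_zero := H.left_ne_zero
  isCoprime := H.isCoprime.symm

variable [CharZero K]

/-- Since `D² f·g = 0` and `g` is invertible modulo `f`, the ideal `(f, f')` is closed under
derivation; in characteristic zero its generator must then be constant. -/
theorem separable_of_hirotaD2_eq_zero (hf : f ≠ 0) (hfg : IsCoprime f g)
    (h2 : hirotaD2 derivative' f g = 0) : f.Separable := by
  classical
  obtain ⟨d, hd⟩ : ∃ d, EuclideanDomain.gcd f (derivative f) = d := ⟨_, rfl⟩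
  have df : d ∣ f := hd ▸ EuclideanDomain.gcd_dvd_left _ _
  have df' : d ∣ derivative f := hd ▸ EuclideanDomain.gcd_dvd_right _ _
  have df'' : d ∣ derivative (derivative f) := by
    have hf'' : derivative (derivative f) * g =
        derivative f * (2 * derivative g) - f * derivative (derivative g) := by
      simp only [hirotaD2, derivative'_apply] at h2
      linear_combination h2
    exact (hfg.of_isCoprime_of_dvd_left df).dvd_of_dvd_mul_right
      (hf'' ▸ dvd_sub (df'.mul_right _) (df.mul_right _))
  have dd : d ∣ derivative d := by
    have hbezout := EuclideanDomain.gcd_eq_gcd_ab f (derivative f)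
    rw [hd] at hbezout
    rw [congrArg derivative hbezout]
    simp only [derivative_add, derivative_mul]
    exact dvd_add (dvd_add (df'.mul_right _) (df.mul_right _))
      (dvd_add (df''.mul_right _) (df'.mul_right _))
  have hd0 : d ≠ 0 := ne_zero_of_dvd_ne_zero hf df
  have hdeg : d.natDegree = 0 := derivative_eq_zero.mp (dvd_derivative_iff.mp dd)
  rw [separable_def, ← EuclideanDomain.gcd_isUnit_iff, hd, isUnit_iff_degree_eq_zero,
    degree_eq_natDegree hd0, hdeg, Nat.cast_zero]

theorem IsTauPair.separable_left (H : IsTauPair ν f g) : f.Separable :=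
  separable_of_hirotaD2_eq_zero H.left_ne_zero H.isCoprime H.hirotaD2_eq_zero

theorem IsTauPair.dvd_todaPolynomial (H : IsTauPair ν f g) :
    f ∣ todaPolynomial derivative' X g :=
  H.separable_left.dvd_of_dvd_mul_left
    (H.derivation_mul_todaPolynomial ▸ dvd_mul_right _ _)

theorem IsTauPair.isCoprime_right (H : IsTauPair ν f g)
    (hN : h * f = todaPolynomial derivative' X g) : IsCoprime g h := by
  have hsep : IsCoprime g (derivative g) := H.symm.separable_left
  have h4 : IsCoprime g (C 4 * derivative g ^ 2) :=
    .mul_right (isCoprime_one_right.of_isCoprime_of_dvd_right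
      (isUnit_C.mpr (IsUnit.mk0 4 (by norm_num : (4 : K) ≠ 0))).dvd) hsep.pow_right
  have hmod : h * f = C 4 * derivative g ^ 2 + g * (X * g - 4 * derivative (derivative g)) := by
    rw [hN, todaPolynomial, map_ofNat]
    simp only [derivative'_apply]
    ring
  exact .of_mul_right_left (hmod ▸ h4.add_mul_left_right _)

theorem IsTauPair.backlund (H : IsTauPair ν f g) (hN : h * f = todaPolynomial derivative' X g) :
    IsTauPair (ν + 1) g h where
  toIsHirotaPair := by
    rw [C_add, C_1]
    exact H.toIsHirotaPair.backlund H.left_ne_zero H.right_ne_zero derivative_X derivative_C hN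
  left_ne_zero := H.right_ne_zero
  right_ne_zero := left_ne_zero_of_mul (hN ▸ todaPolynomial_ne_zero H.right_ne_zero)
  isCoprime := H.isCoprime_right hN

/-- Near a root of `f`, the quotients `φ = f / g` and `ψ = h / g`, with `h` the Bäcklund successor
of `g`, solve the same Schrödinger equation with potential `2 (log g)''`. -/
theorem IsTauPair.exists_schrodinger_pair (H : IsTauPair ν f g) (hs : g.Splits) {z : K}
    (hz : f.IsRoot z) :
    ∃ φ ψ : PowerSeries K,
      PowerSeries.derivative K (PowerSeries.derivative K φ) =
        -(2 * PowerSeries.derivative K (logDerivSeries g.roots z) * φ) ∧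
      PowerSeries.derivative K (PowerSeries.derivative K ψ) =
        -(2 * PowerSeries.derivative K (logDerivSeries g.roots z) * ψ) ∧
      φ * PowerSeries.derivative K ψ - ψ * PowerSeries.derivative K φ =
        PowerSeries.C (2 * ν + 1) ∧
      φ * ψ = PowerSeries.X + PowerSeries.C z -
        4 * PowerSeries.derivative K (logDerivSeries g.roots z) ∧
      PowerSeries.constantCoeff φ = 0 := by
  obtain ⟨h, hN⟩ := H.dvd_todaPolynomial
  rw [mul_comm] at hN
  have hgz := H.eval_right_ne_zero hz
  have hu := isUnit_taylorSeries hgz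
  have hG := derivative_taylorSeries_of_splits hs hgz
  have hT := taylorSeries_derivative z
  obtain ⟨φ, hφ⟩ := hu.dvd (a := taylorSeries z f)
  obtain ⟨ψ, hψ⟩ := hu.dvd (a := taylorSeries z h)
  have hcancel := mul_right_injective₀ (pow_ne_zero 2 hu.ne_zero)
  refine ⟨φ, ψ, schrodinger_of_hirotaD2_eq_zero hu.ne_zero hG ?_,
    schrodinger_of_hirotaD2_eq_zero hu.ne_zero hG ?_, hcancel ?_, hcancel ?_, ?_⟩
  · rw [← hφ, ← map_hirotaD2 (δ := derivative') hT, H.hirotaD2_eq_zero, map_zero]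
  · rw [← hψ, ← map_hirotaD2 (δ := derivative') hT, hirotaD2_comm,
      (H.backlund hN.symm).hirotaD2_eq_zero, map_zero]
  · have hw := congrArg (taylorSeries z) (H.wronskian_eq H.left_ne_zero derivative_X hN.symm)
    simp only [derivative'_apply, map_sub, map_mul, map_pow, hT, hφ, hψ, wronskian_mul_left] at hw
    have hc : taylorSeries z (2 * C ν + 1) = PowerSeries.C (2 * ν + 1) := by
      simp only [map_add, map_mul, map_ofNat, map_one, taylorSeries_C]
    exact hw.trans (by rw [hc, mul_comm])
  · have hv := congrArg (taylorSeries z) hN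
    rw [map_todaPolynomial hT, todaPolynomial_of_logDeriv hG, map_mul, hφ, hψ, taylorSeries_X] at hv
    linear_combination -hv
  · have h0 := congrArg PowerSeries.constantCoeff hφ
    rw [map_mul, constantCoeff_taylorSeries, constantCoeff_taylorSeries, hz.eq_zero, eq_comm] at h0
    exact (mul_eq_zero.mp h0).resolve_left hgz

theorem IsTauPair.root_sums (H : IsTauPair ν f g) (hs : g.Splits) {z : K} (hz : f.IsRoot z) :
    (g.roots.map fun w => 1 / (z - w) ^ 2).sum = -(z / 4) ∧
      (g.roots.map fun w => 1 / (z - w) ^ 3).sum = (ν + 1) / 4 ∧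
      (g.roots.map fun w => 1 / (z - w) ^ 5).sum = -(z * (2 * ν + 1) / 48) := by
  have hcoeff := coeff_logDerivSeries fun h => H.eval_right_ne_zero hz (isRoot_of_mem_roots h)
  obtain ⟨φ, ψ, hφ, hψ, hw, hv, h0⟩ := H.exists_schrodinger_pair hs hz
  obtain ⟨G₁, G₂, G₄⟩ := coeff_of_schrodinger_pair hφ hψ hw hv h0
  rw [hcoeff] at G₁ G₂ G₄
  exact ⟨by linear_combination -G₁, by linear_combination G₂, by linear_combination G₄⟩

end TauPair

section YablonskiiVorobev

theorem yablonskiiVorobev_add_two (n : ℕ) :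
    yablonskiiVorobev (n + 2) =
      todaPolynomial derivative' X (yablonskiiVorobev (n + 1)) / yablonskiiVorobev n :=
  yablonskiiVorobev.eq_3 n

theorem yablonskiiVorobev_add_two_mul_of_isTauPair {n : ℕ} {ν : ℂ}
    (H : IsTauPair ν (yablonskiiVorobev n) (yablonskiiVorobev (n + 1))) :
    yablonskiiVorobev (n + 2) * yablonskiiVorobev n =
      todaPolynomial derivative' X (yablonskiiVorobev (n + 1)) := by
  rw [yablonskiiVorobev_add_two, mul_comm]
  exact EuclideanDomain.mul_div_cancel' H.left_ne_zero H.dvd_todaPolynomial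

theorem isTauPair_yablonskiiVorobev (n : ℕ) :
    IsTauPair ((n : ℂ) + 1) (yablonskiiVorobev n) (yablonskiiVorobev (n + 1)) := by
  induction n with
  | zero =>
    rw [yablonskiiVorobev, yablonskiiVorobev]
    exact {
      hirotaD2_eq_zero := by simp [hirotaD2]
      hirotaD3_eq := by simp [hirotaD3]
      left_ne_zero := one_ne_zero
      right_ne_zero := X_ne_zero
      isCoprime := isCoprime_one_left }
  | succ n ih =>
    rw [Nat.cast_succ]
    exact ih.backlund (yablonskiiVorobev_add_two_mul_of_isTauPair ih)

theorem yablonskiiVorobev_add_two_mul (n : ℕ) :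
    yablonskiiVorobev (n + 2) * yablonskiiVorobev n =
      todaPolynomial derivative' X (yablonskiiVorobev (n + 1)) :=
  yablonskiiVorobev_add_two_mul_of_isTauPair (isTauPair_yablonskiiVorobev n)

theorem two_mul_natDegree_yablonskiiVorobev (n : ℕ) :
    2 * (yablonskiiVorobev n).natDegree = n * (n + 1) := by
  induction n using Nat.twoStepInduction with
  | zero => simp [yablonskiiVorobev]
  | one => simp [yablonskiiVorobev]
  | more n ih₀ ih₁ =>
    have hdeg := natDegree_add_of_mul_eq_todaPolynomial
      (isTauPair_yablonskiiVorobev n).right_ne_zero (yablonskiiVorobev_add_two_mul n)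
    linarith

theorem card_roots_yablonskiiVorobev (n : ℕ) :
    (yablonskiiVorobev n).roots.card = n * (n + 1) / 2 := by
  rw [← (IsAlgClosed.splits _).natDegree_eq_card_roots,
    ← two_mul_natDegree_yablonskiiVorobev, Nat.mul_div_cancel_left _ two_pos]

end YablonskiiVorobev

theorem mainTheorem4 (n : ℕ) (hn : 1 ≤ n) :
    -- the polynomials satisfy their defining equation, and have the right number of roots
    (yablonskiiVorobev (n + 1) * yablonskiiVorobev (n - 1) =
      X * yablonskiiVorobev n ^ 2
        - 4 * (yablonskiiVorobev n * derivative (derivative (yablonskiiVorobev n))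
          - derivative (yablonskiiVorobev n) ^ 2)) ∧
    ((yablonskiiVorobev (n - 1)).roots.card = n * (n - 1) / 2 ∧
      (yablonskiiVorobev n).roots.card = n * (n + 1) / 2) ∧
    -- no denominator below vanishes
    (∀ z ∈ (yablonskiiVorobev (n - 1)).roots, ∀ w ∈ (yablonskiiVorobev n).roots, z ≠ w) ∧
    -- sums over the roots of `Q_n`, at each root of `Q_{n-1}`
    (∀ z ∈ (yablonskiiVorobev (n - 1)).roots,
      rootSum n 2 z = -(z / 4) ∧
      rootSum n 3 z = ((n : ℂ) + 1) / 4 ∧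
      rootSum n 5 z = -z * (((n : ℂ) + 1) / 24 - 1 / 48)) ∧
    -- sums over the roots of `Q_{n-1}`, at each root of `Q_n`
    (∀ z ∈ (yablonskiiVorobev n).roots,
      rootSum (n - 1) 2 z = -(z / 4) ∧
      rootSum (n - 1) 3 z = -(((n : ℂ) - 1) / 4) ∧
      rootSum (n - 1) 5 z = z * (((n : ℂ) - 1) / 24 + 1 / 48)) := by
  obtain ⟨m, rfl⟩ := Nat.exists_eq_add_of_le' hn
  have H := isTauPair_yablonskiiVorobev m
  rw [Nat.add_sub_cancel]
  refine ⟨yablonskiiVorobev_add_two_mul m, ⟨?_, card_roots_yablonskiiVorobev (m + 1)⟩, ?_, ?_, ?_⟩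
  · rw [card_roots_yablonskiiVorobev, mul_comm]
  · rintro z hz _ hw rfl
    exact H.eval_right_ne_zero (isRoot_of_mem_roots hz) (isRoot_of_mem_roots hw)
  · intro z hz
    obtain ⟨h2, h3, h5⟩ := H.root_sums (IsAlgClosed.splits _) (isRoot_of_mem_roots hz)
    refine ⟨h2, h3.trans ?_, h5.trans ?_⟩ <;> push_cast <;> ring
  · intro z hz
    obtain ⟨h2, h3, h5⟩ := H.symm.root_sums (IsAlgClosed.splits _) (isRoot_of_mem_roots hz)
    refine ⟨h2, h3.trans ?_, h5.trans ?_⟩ <;> push_cast <;> ring
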